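/- Let $V\neq 0$ be a finite-dimensional real vector space with a finite increasing filtration $W$ (so $W_k=0$ for $k\ll0$ and $W_k=V$ for $k\gg0$), let $\langle\,,\rangle_w$ be non-degenerate bilinear forms on $Gr^W_w=W_w/W_{w-1}$, symmetric for $w$ even and antisymmetric for $w$ odd, and let $h^{p,q}=h^{q,p}\ge 0$ be integers with $\dim Gr^W_w=\sum_{p+q=w}h^{p,q}$ for all $w$. Let $\mathcal M$ be the set of all decreasing filtrations $F$ of $V_{\mathbb C}$ such that $(F,W)$ is a mixed Hodge structure and, for every $w$, $(Gr^W_w,F Gr^W_w)$ is a Hodge structure of weight $w$ with Hodge numbers $h^{p,q}$ $(p+q=w)$ polarized by $\langle\,,\rangle_w$ (with the sign convention $i^{p-q}\langle u,\bar u\rangle_w>0$ for $0\ne u$ of type $(p,q)$). For $F\in\mathcal M$ let $V_{\mathbb C}=\bigoplus I^{p,q}$ be the Deligne bigrading of $(F,W)$, i.e. the unique bigrading with $F^p=\bigoplus_{a\ge p}I^{a,b}$, $W_k=\bigoplus_{a+b\le k}I^{a,b}$ and $I^{p,q}\equiv\overline{I^{q,p}}$ modulo $\bigoplus_{r<p,\,s<q}I^{r,s}$,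 and let $h_F$ be the hermitian inner product on $V_{\mathbb C}$ for which the $I^{p,q}$ are mutually orthogonal and $h_F(u,v)=i^{p-q}\langle gr_{p+q}u,gr_{p+q}\bar v\rangle_{p+q}$ for $u,v\in I^{p,q}$. Let $G_{\mathbb C}$ be the group of automorphisms of $V_{\mathbb C}$ which preserve $W$ and act on each $Gr^W_{w,\mathbb C}$ by isometries of $\langle\,,\rangle_w$, let $\mathfrak g_{\mathbb C}$ be its Lie algebra, and let $\mathfrak g^{p,q}$ be the set of elements of $\mathfrak g_{\mathbb C}$ which map $I^{a,b}$ into $I^{a+p,b+q}$ for all $a,b$. The space $\mathcal M$ is an open subset of a homogeneous space of $G_{\mathbb C}$, and $T_F(\mathcal M)$ is identified with $\bigoplus_{p<0,\,p+q\le0}\mathfrak g^{p,q}$ by $v\mapsto\frac{d}{dt}e^{tv}.F|_{t=0}$. The standard metric on $\mathcal M$ is $h_F(\alpha,\beta)=\mathrm{Tr}(\alpha\beta^*)$ for $\alpha,\beta\in T_F(\mathcal M)$, where $\beta^*$ is the adjoint of $\beta$ with respect to $h_F$, and $d(F,F')\in[0,\infty]$ is the infimum of the lengths of the smooth curves in $\mathcal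 M$ from $F$ to $F'$ ($\infty$ if there are none). Let $Y$ be a real grading of $W$, i.e. a semisimple endomorphism $Y$ of $V$ such that, for every $k$, $W_k$ is the direct sum of $W_{k-1}$ and the $k$-eigenspace of $Y$. Let $\alpha<0$, $y>1$ and $y^{\alpha Y}=\exp(\alpha\log(y)\,Y)$, and let $L=\min\{k\mid W_k=V\}-\max\{k\mid W_k=0\}$ be the length of $W$. Then for all $F,F'\in\mathcal M$ the filtrations $y^{\alpha Y}.F$ and $y^{\alpha Y}.F'$ belong to $\mathcal M$, and $$d(y^{\alpha Y}.F,\;y^{\alpha Y}.F')\;\le\; y^{-\alpha(L-1)}\,d(F,F').$$ -/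

import Mathlib

open scoped TensorProduct ContDiff Topology
open Set

noncomputable section

namespace MixedHodge

/-! ### Complexification of real vector spaces -/

section Complexification

variable (U : Type*) [AddCommGroup U] [Module ℝ U]

/-- The complexification `U_ℂ = U ⊗ ℂ` of a real vector space. -/
abbrev Cx : Type _ := ℂ ⊗[ℝ] U

/-- Complex conjugation `z ⊗ u ↦ z̄ ⊗ u` on `U_ℂ`. -/
def conj : Cx U →ₛₗ[starRingEnd ℂ] Cx U where
  toFun := TensorProduct.map Complex.conjAe.toLinearMap (LinearMap.id : U →ₗ[ℝ] U)
  map_add' := map_add _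
  map_smul' := by
    intro c x
    induction x using TensorProduct.induction_on with
    | zero => simp
    | tmul z u => simp [TensorProduct.smul_tmul']
    | add a b ha hb => rw [smul_add, map_add, ha, hb, map_add, smul_add]

variable {U}

/-- The complex conjugate `{x | x̄ ∈ S}` of a complex subspace `S` of `U_ℂ`. -/
def conjSubspace (S : Submodule ℂ (Cx U)) : Submodule ℂ (Cx U) := S.comap (conj U)

end Complexification

/-- Polarized real Hodge structures of weight `w`: `Φ` is the Hodge filtration on `H_ℂ`,
`B` the (real) polarization; the Hodge component of type `(p,q)`, `p + q = w`, is
`Φ p ⊓ conj (Φ q)`. -/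
structure IsPolarizedHodgeStructure {H : Type*} [AddCommGroup H] [Module ℝ H] (w : ℤ)
    (B : LinearMap.BilinForm ℝ H) (Φ : ℤ → Submodule ℂ (Cx H)) : Prop where
  antitone : Antitone Φ
  exists_top : ∃ p, Φ p = ⊤
  exists_bot : ∃ p, Φ p = ⊥
  isCompl : ∀ p, IsCompl (Φ p) (conjSubspace (Φ (w + 1 - p)))
  orthogonal : ∀ p q, w < p + q → ∀ u ∈ Φ p, ∀ v ∈ Φ q, B.baseChange ℂ u v = 0
  positive : ∀ p q, p + q = w → ∀ u ∈ Φ p ⊓ conjSubspace (Φ q), u ≠ 0 →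
    0 < (Complex.I ^ (p - q) * B.baseChange ℂ u (conj H u)).re

variable {V : Type*} [AddCommGroup V] [Module ℝ V]

/-! ### Filtrations and graded quotients -/

/-- `Gr^W_w = W_w / W_{w-1}`. -/
abbrev Gr (W : ℤ → Submodule ℝ V) (w : ℤ) : Type _ :=
  (W w) ⧸ (W (w - 1)).submoduleOf (W w)

/-- The inclusion `(W_w)_ℂ → V_ℂ`. -/
def incl (W : ℤ → Submodule ℝ V) (w : ℤ) : Cx (W w) →ₗ[ℂ] Cx V :=
  (W w).subtype.baseChange ℂ

/-- The projection `(W_w)_ℂ → (Gr^W_w)_ℂ`. -/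
def gr (W : ℤ → Submodule ℝ V) (w : ℤ) : Cx (W w) →ₗ[ℂ] Cx (Gr W w) :=
  ((W (w - 1)).submoduleOf (W w)).mkQ.baseChange ℂ

/-- The filtration induced by `F` on `(Gr^W_w)_ℂ`. -/
def grFiltration (W : ℤ → Submodule ℝ V) (F : ℤ → Submodule ℂ (Cx V)) (w p : ℤ) :
    Submodule ℂ (Cx (Gr W w)) :=
  ((F p).comap (incl W w)).map (gr W w)

/-- The length `min {k | W_k = V} - max {k | W_k = 0}` of a filtration. -/
def filtrationLength (W : ℤ → Submodule ℝ V) : ℤ :=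
  sInf {k | W k = ⊤} - sSup {k | W k = ⊥}

/-- A real grading of `W`: a semisimple endomorphism `Y` of `V` such that `W_k` is the
direct sum of `W_{k-1}` and the `k`-eigenspace of `Y`, for every `k`. -/
structure IsRealGrading (W : ℤ → Submodule ℝ V) (Y : Module.End ℝ V) : Prop where
  isSemisimple : Y.IsSemisimple
  sup_eq : ∀ k : ℤ, W (k - 1) ⊔ Y.eigenspace (k : ℝ) = W k
  disjoint : ∀ k : ℤ, Disjoint (W (k - 1)) (Y.eigenspace (k : ℝ))

/-- The exponential of an endomorphism of a finite-dimensional real vector space, computed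
as a matrix exponential in a basis (it does not depend on the basis). -/
def expEnd [FiniteDimensional ℝ V] (X : Module.End ℝ V) : Module.End ℝ V :=
  Matrix.toLin (Module.finBasis ℝ V) (Module.finBasis ℝ V)
    (NormedSpace.exp (LinearMap.toMatrix (Module.finBasis ℝ V) (Module.finBasis ℝ V) X))

/-- `y ^ X = exp (log y • X)`. -/
def powEnd [FiniteDimensional ℝ V] (y : ℝ) (X : Module.End ℝ V) : Module.End ℝ V :=
  expEnd (Real.log y • X)

/-- The image `g.F` of a filtration of `V_ℂ` under an endomorphism `g` of `V_ℂ`. -/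
def act (g : Module.End ℂ (Cx V)) (F : ℤ → Submodule ℂ (Cx V)) : ℤ → Submodule ℂ (Cx V) :=
  fun p => (F p).map g

/-! ### The classifying space -/

/-- The data defining a classifying space of graded-polarized mixed Hodge structures on `V`:
a finite increasing filtration `W`, a nondegenerate `(-1)^w`-symmetric bilinear form on each
`Gr^W_w`, and Hodge numbers `h p q` (in weight `p + q`). -/
structure Data (V : Type*) [AddCommGroup V] [Module ℝ V] where
  W : ℤ → Submodule ℝ V
  monotone : Monotone W
  exists_bot : ∃ k, W k = ⊥
  exists_top : ∃ k, W k = ⊤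
  form : ∀ w : ℤ, LinearMap.BilinForm ℝ (Gr W w)
  nondegenerate : ∀ w, (form w).Nondegenerate
  symm_of_even : ∀ w, Even w → ∀ x y, form w x y = form w y x
  antisymm_of_odd : ∀ w, Odd w → ∀ x y, form w x y = -form w y x
  h : ℤ → ℤ → ℕ
  h_symm : ∀ p q, h p q = h q p
  h_finite : ∀ w, {p : ℤ | h p (w - p) ≠ 0}.Finite
  finrank_gr : ∀ w, Module.finrank ℝ (Gr W w) = ∑ᶠ p : ℤ, h p (w - p)

namespace Data

variable (D : Data V)

/-- The classifying space `ℳ`: the set of all (finite) decreasing filtrations `F` of `V_ℂ`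
such that `(F, W)` induces on every `Gr^W_w` a Hodge structure of weight `w` (so that `(F, W)`
is a mixed Hodge structure) which is polarized by the given form and has the given Hodge
numbers. -/
def M : Set (ℤ → Submodule ℂ (Cx V)) :=
  {F | Antitone F ∧ (∃ p, F p = ⊤) ∧ (∃ p, F p = ⊥) ∧
    ∀ w, IsPolarizedHodgeStructure w (D.form w) (grFiltration D.W F w) ∧
      ∀ p q, p + q = w →
        Module.finrank ℂ ↥(grFiltration D.W F w p ⊓ conjSubspace (grFiltration D.W F w q))
          = D.h p q}

/-- The group `G_ℂ` of the automorphisms of `V_ℂ` which preserve `W` and induce isometries of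
every `(Gr^W_w)_ℂ`. -/
def GC : Set (Cx V ≃ₗ[ℂ] Cx V) :=
  {g | (∀ w, ((D.W w).baseChange ℂ).map (g : Module.End ℂ (Cx V)) = (D.W w).baseChange ℂ) ∧
    ∀ w, ∀ u v u' v' : Cx (D.W w),
      incl D.W w u' = g (incl D.W w u) → incl D.W w v' = g (incl D.W w v) →
        (D.form w).baseChange ℂ (gr D.W w u') (gr D.W w v')
          = (D.form w).baseChange ℂ (gr D.W w u) (gr D.W w v)}

/-- Membership in the Lie algebra `𝔤_ℂ` of `G_ℂ`. -/
def IsInLieAlgebra (X : Module.End ℂ (Cx V)) : Prop :=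
  (∀ w, ((D.W w).baseChange ℂ).map X ≤ (D.W w).baseChange ℂ) ∧
    ∀ w, ∀ u v u' v' : Cx (D.W w),
      incl D.W w u' = X (incl D.W w u) → incl D.W w v' = X (incl D.W w v) →
        (D.form w).baseChange ℂ (gr D.W w u') (gr D.W w v)
          + (D.form w).baseChange ℂ (gr D.W w u) (gr D.W w v') = 0

/-- `I` is the Deligne bigrading of the mixed Hodge structure `(F, W)`
(by a theorem of Deligne it exists and is unique). -/
structure IsDeligneBigrading (F : ℤ → Submodule ℂ (Cx V)) (I : ℤ → ℤ → Submodule ℂ (Cx V)) :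
    Prop where
  isInternal : DirectSum.IsInternal fun pq : ℤ × ℤ => I pq.1 pq.2
  hodge : ∀ p, F p = ⨆ (a : ℤ) (b : ℤ) (_ : p ≤ a), I a b
  weight : ∀ k, (D.W k).baseChange ℂ = ⨆ (a : ℤ) (b : ℤ) (_ : a + b ≤ k), I a b
  conj_mod : ∀ p q,
    I p q ⊔ (⨆ (r : ℤ) (s : ℤ) (_ : r < p ∧ s < q), I r s)
      = conjSubspace (I q p) ⊔ (⨆ (r : ℤ) (s : ℤ) (_ : r < p ∧ s < q), I r s)

/-- The mixed Hodge metric attached to the Deligne bigrading `I`: the hermitian inner product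
`h` on `V_ℂ` for which the bigrading is orthogonal and such that
`h(u,v) = i^{p-q} ⟨gr u, gr v̄⟩_{p+q}` for `u, v ∈ I^{p,q}`. The form `h` is linear in the
first variable, whereas `c.inner` is linear in the second one, so `h(u,v) = c.inner v u`. -/
structure IsMixedHodgeMetric (I : ℤ → ℤ → Submodule ℂ (Cx V))
    (c : InnerProductSpace.Core ℂ (Cx V)) : Prop where
  orthogonal : ∀ p q p' q', (p, q) ≠ (p', q') → ∀ u ∈ I p q, ∀ v ∈ I p' q', c.inner v u = 0
  inner_eq : ∀ p q, ∀ u v : Cx (D.W (p + q)),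
    incl D.W (p + q) u ∈ I p q → incl D.W (p + q) v ∈ I p q →
      c.inner (incl D.W (p + q) v) (incl D.W (p + q) u)
        = Complex.I ^ (p - q) *
          (D.form (p + q)).baseChange ℂ (gr D.W (p + q) u) (gr D.W (p + q) (conj _ v))

/-- The component `𝔤^{p,q}` of `𝔤_ℂ`: the elements which map `I^{a,b}` to `I^{a+p,b+q}`. -/
def lieComponent (I : ℤ → ℤ → Submodule ℂ (Cx V)) (p q : ℤ) :
    Set (Module.End ℂ (Cx V)) :=
  {X | D.IsInLieAlgebra X ∧ ∀ a b, (I a b).map X ≤ I (a + p) (b + q)}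

/-- The subspace `⨁_{p<0, p+q≤0} 𝔤^{p,q}`, a model of the tangent space `T_F(ℳ)` when `I` is
the Deligne bigrading of `(F, W)`. -/
def tangentModel (I : ℤ → ℤ → Submodule ℂ (Cx V)) : Submodule ℂ (Module.End ℂ (Cx V)) :=
  Submodule.span ℂ (⋃ (p : ℤ) (q : ℤ) (_ : p < 0 ∧ p + q ≤ 0), D.lieComponent I p q)

end Data

/-- The hermitian form `(a, b) ↦ Tr (a b^*)` on endomorphisms of `E`, where `b^*` is the
adjoint of `b` with respect to the hermitian inner product `c` on `E`. -/
def traceForm {E : Type*} [AddCommGroup E] [Module ℂ E] [FiniteDimensional ℂ E]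
    (c : InnerProductSpace.Core ℂ E) (a b : Module.End ℂ E) : ℂ :=
  letI : NormedAddCommGroup E := c.toNormedAddCommGroup
  letI : InnerProductSpace ℂ E := InnerProductSpace.ofCore c.toCore
  LinearMap.trace ℂ E (a * LinearMap.adjoint b)

namespace Data

variable (D : Data V)

/-- The curve `γ`, defined on `[0,1]`, is smooth near `u` with values in a single orbit of
`G_ℂ`, and has there the velocity `d/ds (e^{sv}.γ(u))|_{s=0}`: near `u`, `γ(t) = g(t).γ(u)` for
a smooth (in terms of matrix coefficients) curve `g` in `G_ℂ` with `g(u) = 1`, `g'(u) = v`. -/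
def HasVelocity (γ : ℝ → ℤ → Submodule ℂ (Cx V)) (u : ℝ) (v : Module.End ℂ (Cx V)) : Prop :=
  ∃ g : ℝ → (Cx V ≃ₗ[ℂ] Cx V),
    (∀ᶠ t in 𝓝[Icc 0 1] u, g t ∈ D.GC ∧ γ t = act (g t : Module.End ℂ (Cx V)) (γ u)) ∧
    g u = LinearEquiv.refl ℂ (Cx V) ∧
    (∀ (φ : Module.Dual ℂ (Cx V)) (x : Cx V),
      ContDiffWithinAt ℝ ∞ (fun t => φ (g t x)) (Icc 0 1) u) ∧
    ∀ (φ : Module.Dual ℂ (Cx V)) (x : Cx V),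
      HasDerivWithinAt (fun t => φ (g t x)) (φ (v x)) (Icc 0 1) u

variable [FiniteDimensional ℝ V]

/-- The curve `γ` is smooth near `u`, and `s = ‖γ'(u)‖` is the length of its velocity for the
standard metric `h_F(a,b) = Tr (a b^*)` on `T_F(ℳ)`, `F = γ(u)`. Here the bigrading `I`, the
inner product `c` and the representative `v` of `γ'(u)` are uniquely determined. -/
def HasSpeed (γ : ℝ → ℤ → Submodule ℂ (Cx V)) (u s : ℝ) : Prop :=
  ∃ (I : ℤ → ℤ → Submodule ℂ (Cx V)) (c : InnerProductSpace.Core ℂ (Cx V))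
    (v : Module.End ℂ (Cx V)),
    D.IsDeligneBigrading (γ u) I ∧ D.IsMixedHodgeMetric I c ∧ v ∈ D.tangentModel I ∧
      D.HasVelocity γ u v ∧ s = √(traceForm c v v).re

/-- The distance on `ℳ` defined by the standard metric: the infimum of the lengths
`∫₀¹ ‖γ'(u)‖ du` of the smooth curves in `ℳ` from `F` to `F'` (it is `∞` if there is no such
curve, that is, if `F` and `F'` lie in different connected components of `ℳ`). -/
def dist (F F' : ℤ → Submodule ℂ (Cx V)) : ENNReal :=
  ⨅ (γ : ℝ → ℤ → Submodule ℂ (Cx V)) (s : ℝ → ℝ)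
    (_ : γ 0 = F ∧ γ 1 = F' ∧ ∀ u ∈ Icc (0 : ℝ) 1, γ u ∈ D.M ∧ D.HasSpeed γ u (s u)),
    ∫⁻ u in Icc (0 : ℝ) 1, ENNReal.ofReal (s u)

end Data

end MixedHodge

end

noncomputable section

namespace MixedHodge

/-! ### The exponential of an endomorphism -/

section Exponential

/-! Put `g = y ^ (αY)`. It is real, preserves `W`, and acts on `Gr_k` as the scalar `c k = y ^
(αk)`. Scalars do not move subspaces, so `F` and `g.F` induce the same filtrations on the graded
quotients and `g` maps `ℳ` to itself. Since `g` is real and preserves `W`, the Deligne bigrading of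
`g.F` is `g I`; since scalars commute with everything on `Gr`, `g` normalizes `G_ℂ` and carries a
velocity `v` at `F` to `g v g⁻¹` at `g.F`.

The metric is not preserved. If `δ` denotes multiplication by `c (p+q)` on `I^{p,q}`, then `h_{g.F}`
is the pullback of `h_F` along `δ g⁻¹` (`IsMixedHodgeMetric.map`). Hence the norm of `g v g⁻¹` at
`g.F` is the norm of `δ v δ⁻¹` at `F`: the block of `v` from weight `k` to weight `l` is multiplied
by `c l / c k = y ^ (-α(k-l))` (`traceForm_conj_re_le`). Weights of nonzero pieces differ by at most
`L - 1` (`weight_sub_le`), so every speed grows by a factor of at most `y ^ (-α(L-1))`; integrating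
along curves gives the bound (`dist_act_le`). -/

theorem exp_mulVec_of_mulVec_eq_smul {n : Type*} [Fintype n] [DecidableEq n]
    (A : Matrix n n ℝ) (v : n → ℝ) (μ : ℝ) (h : A.mulVec v = μ • v) :
    (NormedSpace.exp A).mulVec v = Real.exp μ • v := by
  -- An auxiliary submultiplicative norm, chosen only to make the exponential series converge.
  let _ : NormedRing (Matrix n n ℝ) := Matrix.linftyOpNormedRing
  let _ : NormedAlgebra ℝ (Matrix n n ℝ) := Matrix.linftyOpNormedAlgebra
  have hpow : ∀ k : ℕ, (A ^ k).mulVec v = μ ^ k • v := by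
    intro k
    induction k with
    | zero => simp
    | succ k ih =>
      rw [pow_succ', ← Matrix.mulVec_mulVec, ih, Matrix.mulVec_smul, h, smul_smul, pow_succ]
  have h1 : HasSum (fun k : ℕ => ((k.factorial : ℝ)⁻¹) • A ^ k) (NormedSpace.exp A) :=
    NormedSpace.exp_series_hasSum_exp' A
  have hcont : Continuous fun M : Matrix n n ℝ => M.mulVec v :=
    continuous_id.matrix_mulVec continuous_const
  have h2 := h1.map (Matrix.mulVec.addMonoidHomLeft v) hcont
  have h3 : HasSum (fun k : ℕ => ((k.factorial : ℝ)⁻¹) • μ ^ k) (Real.exp μ) := by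
    rw [Real.exp_eq_exp_ℝ]
    exact NormedSpace.exp_series_hasSum_exp' μ
  have h4 := h3.smul_const v
  refine h2.unique ?_
  convert h4 using 1
  · funext k
    change (((k.factorial : ℝ)⁻¹) • A ^ k).mulVec v = _
    rw [Matrix.smul_mulVec, hpow, smul_smul, smul_eq_mul]

variable {V : Type*} [AddCommGroup V] [Module ℝ V] [FiniteDimensional ℝ V]

theorem expEnd_apply_of_apply_eq_smul (X : Module.End ℝ V) (x : V) (μ : ℝ) (h : X x = μ • x) :
    expEnd X x = Real.exp μ • x := by
  set b := Module.finBasis ℝ V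
  apply b.repr.injective
  apply DFunLike.coe_injective
  have h1 : (LinearMap.toMatrix b b X).mulVec (b.repr x) = μ • ⇑(b.repr x) := by
    rw [LinearMap.toMatrix_mulVec_repr, h, map_smul, Finsupp.coe_smul]
  have h2 := exp_mulVec_of_mulVec_eq_smul _ _ _ h1
  rw [map_smul, Finsupp.coe_smul, ← h2, ← LinearMap.toMatrix_mulVec_repr b b]
  simp [expEnd, b]

theorem expEnd_mul_expEnd_neg (X : Module.End ℝ V) : expEnd X * expEnd (-X) = 1 := by
  unfold expEnd
  set b := Module.finBasis ℝ V
  have h : Commute (LinearMap.toMatrix b b X) (-LinearMap.toMatrix b b X) :=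
    (Commute.refl _).neg_right
  rw [Module.End.mul_eq_comp, ← Matrix.toLin_mul, map_neg, ← Matrix.exp_add_of_commute _ _ h,
    add_neg_cancel, NormedSpace.exp_zero, Matrix.toLin_one]
  rfl

/-- `exp X` as an automorphism, with inverse `exp (-X)`. -/
def expEquiv (X : Module.End ℝ V) : V ≃ₗ[ℝ] V :=
  LinearEquiv.ofLinearMap (expEnd X) (expEnd (-X)) (expEnd_mul_expEnd_neg X)
    (by
    have h := expEnd_mul_expEnd_neg (-X)
    rwa [neg_neg] at h)

end Exponential

/-! ### Automorphisms which act on the graded quotients by scalars -/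

section Scaling

variable {V : Type*} [AddCommGroup V] [Module ℝ V]

/-- The automorphism `g` preserves `W` and acts on `Gr^W_k` as multiplication by `c k`. -/
structure IsWeightScaling (W : ℤ → Submodule ℝ V) (c : ℤ → ℝ) (g : V ≃ₗ[ℝ] V) : Prop where
  pos : ∀ k, 0 < c k
  map_mem : ∀ k, ∀ x ∈ W k, g x ∈ W k
  symm_map_mem : ∀ k, ∀ x ∈ W k, g.symm x ∈ W k
  sub_mem : ∀ k, ∀ x ∈ W k, g x - c k • x ∈ W (k - 1)

namespace IsWeightScaling

variable {W : ℤ → Submodule ℝ V} {c : ℤ → ℝ} {g : V ≃ₗ[ℝ] V}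

theorem symm (hg : IsWeightScaling W c g) : IsWeightScaling W (fun k => (c k)⁻¹) g.symm where
  pos k := inv_pos.2 (hg.pos k)
  map_mem := hg.symm_map_mem
  symm_map_mem := hg.map_mem
  sub_mem k x hx := by
    have h := (W (k - 1)).smul_mem (-(c k)⁻¹)
      (hg.symm_map_mem _ _ (hg.sub_mem k _ hx))
    have hc := (hg.pos k).ne'
    have h2 : -(c k)⁻¹ • g.symm (g x - c k • x) = g.symm x - (c k)⁻¹ • x := by
      rw [map_sub, map_smul, LinearEquiv.symm_apply_apply, smul_sub, smul_smul, neg_mul,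
        inv_mul_cancel₀ hc]
      module
    rwa [h2] at h

/-- The restriction of `g⁻¹` to `(W_w)_ℂ`. -/
def pull (hg : IsWeightScaling W c g) (w : ℤ) : Cx (W w) →ₗ[ℂ] Cx (W w) :=
  (g.symm.toLinearMap.restrict (hg.symm_map_mem w)).baseChange ℂ

end IsWeightScaling

/-- The extension of a real automorphism to the complexification. -/
abbrev cxEquiv (g : V ≃ₗ[ℝ] V) : Cx V ≃ₗ[ℂ] Cx V := g.baseChange ℝ ℂ V V

theorem cxEquiv_symm (g : V ≃ₗ[ℝ] V) : (cxEquiv g).symm = cxEquiv g.symm := rfl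

@[simp] theorem conj_tmul {U : Type*} [AddCommGroup U] [Module ℝ U] (z : ℂ) (u : U) :
    conj U (z ⊗ₜ u) = starRingEnd ℂ z ⊗ₜ u := rfl

theorem conj_baseChange {U U' : Type*} [AddCommGroup U] [Module ℝ U] [AddCommGroup U']
    [Module ℝ U'] (f : U →ₗ[ℝ] U') (x : Cx U) :
    conj U' (f.baseChange ℂ x) = f.baseChange ℂ (conj U x) := by
  induction x using TensorProduct.induction_on with
  | zero => simp
  | tmul z u => simp
  | add a b ha hb => simp only [map_add, ha, hb]

theorem conj_cxEquiv (g : V ≃ₗ[ℝ] V) (x : Cx V) :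
    conj V (cxEquiv g x) = cxEquiv g (conj V x) :=
  conj_baseChange (g : V →ₗ[ℝ] V) x

theorem conjSubspace_map (g : V ≃ₗ[ℝ] V) (S : Submodule ℂ (Cx V)) :
    conjSubspace (S.map (cxEquiv g : Module.End ℂ (Cx V)))
      = (conjSubspace S).map (cxEquiv g : Module.End ℂ (Cx V)) := by
  ext x
  rw [Submodule.mem_map_equiv]
  simp only [conjSubspace, Submodule.mem_comap]
  rw [Submodule.mem_map_equiv, cxEquiv_symm, conj_cxEquiv]

namespace IsWeightScaling

variable {W : ℤ → Submodule ℝ V} {c : ℤ → ℝ} {g : V ≃ₗ[ℝ] V}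

theorem incl_pull (hg : IsWeightScaling W c g) (w : ℤ) (u : Cx (W w)) :
    incl W w (hg.pull w u) = (cxEquiv g).symm (incl W w u) := by
  induction u using TensorProduct.induction_on with
  | zero => simp
  | tmul z u => simp [incl, pull]
  | add a b ha hb => simp only [map_add, ha, hb]

/-- The scalar action on `Gr_w` in terms of representatives. Each later comparison of the graded
forms at `F` and `g.F` goes through this identity. -/
theorem gr_eq_smul_gr_pull (hg : IsWeightScaling W c g) (w : ℤ) (u : Cx (W w)) :
    gr W w u = (c w : ℂ) • gr W w (hg.pull w u) := by
  induction u using TensorProduct.induction_on with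
  | zero => simp
  | tmul z u =>
    simp only [gr, pull, LinearMap.baseChange_tmul]
    rw [TensorProduct.smul_tmul', smul_eq_mul, ← Complex.real_smul, TensorProduct.smul_tmul,
      ← map_smul]
    congr 1
    rw [Submodule.mkQ_apply, Submodule.mkQ_apply, Submodule.Quotient.eq]
    have h := hg.sub_mem w _ (hg.symm_map_mem w _ u.2)
    rw [LinearEquiv.apply_symm_apply] at h
    exact h
  | add a b ha hb => simp only [map_add, ha, hb, smul_add]

theorem conj_pull (hg : IsWeightScaling W c g) (w : ℤ) (u : Cx (W w)) :
    conj _ (hg.pull w u) = hg.pull w (conj _ u) :=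
  conj_baseChange _ u

theorem map_baseChange (hg : IsWeightScaling W c g) (w : ℤ) :
    ((W w).baseChange ℂ).map (cxEquiv g : Module.End ℂ (Cx V)) = (W w).baseChange ℂ := by
  apply le_antisymm
  · rintro _ ⟨_, ⟨u, rfl⟩, rfl⟩
    exact ⟨hg.symm.pull w u, hg.symm.incl_pull w u⟩
  · rintro _ ⟨u, rfl⟩
    rw [Submodule.mem_map_equiv]
    exact ⟨hg.pull w u, hg.incl_pull w u⟩

theorem grFiltration_act_le (hg : IsWeightScaling W c g) (F : ℤ → Submodule ℂ (Cx V)) (w p : ℤ) :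
    grFiltration W (act (cxEquiv g : Module.End ℂ (Cx V)) F) w p ≤ grFiltration W F w p := by
  rintro _ ⟨u, hu, rfl⟩
  rw [hg.gr_eq_smul_gr_pull]
  refine Submodule.smul_mem _ _ (Submodule.mem_map_of_mem ?_)
  change incl W w u ∈ Submodule.map _ _ at hu
  rw [Submodule.mem_map_equiv] at hu
  simpa only [Submodule.mem_comap, hg.incl_pull] using hu

theorem act_symm_act (g : V ≃ₗ[ℝ] V) (F : ℤ → Submodule ℂ (Cx V)) :
    act (cxEquiv g.symm : Module.End ℂ (Cx V)) (act (cxEquiv g : Module.End ℂ (Cx V)) F) = F := by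
  funext p
  ext x
  simp only [act]
  rw [Submodule.mem_map_equiv, Submodule.mem_map_equiv]
  rw [cxEquiv_symm g, LinearEquiv.apply_symm_apply]

/-- The reverse inclusion is the same statement for `g⁻¹`, again a weight scaling. -/
theorem grFiltration_act (hg : IsWeightScaling W c g) (F : ℤ → Submodule ℂ (Cx V)) :
    grFiltration W (act (cxEquiv g : Module.End ℂ (Cx V)) F) = grFiltration W F := by
  funext w p
  refine le_antisymm (hg.grFiltration_act_le F w p) ?_
  have h := hg.symm.grFiltration_act_le (act (cxEquiv g : Module.End ℂ (Cx V)) F) w p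
  rwa [act_symm_act] at h

end IsWeightScaling

/-! ### The scaling attached to a real grading -/

namespace IsRealGrading

variable [FiniteDimensional ℝ V] {W : ℤ → Submodule ℝ V} {Y : Module.End ℝ V}

/-- Induction on `k` from a zero step of `W`, splitting each new step into the previous one and an
eigenspace of `Y`, on which the exponential is a known scalar. -/
theorem expEnd_sub_mem (hY : IsRealGrading W Y) (hmono : Monotone W) {k₀ : ℤ} (hk₀ : W k₀ = ⊥)
    (r : ℝ) (k : ℤ) : ∀ x ∈ W k,
      expEnd (r • Y) x ∈ W k ∧ expEnd (r • Y) x - Real.exp (r * k) • x ∈ W (k - 1) := by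
  rcases le_total k k₀ with hk | hk
  · intro x hx
    have : x = 0 := by simpa [hk₀] using hmono hk hx
    subst this
    simp
  · induction k, hk using Int.leInduction with
    | base =>
      intro x hx
      have : x = 0 := by simpa [hk₀] using hx
      subst this
      simp
    | succ k hk ih =>
      intro x hx
      rw [← hY.sup_eq, Submodule.mem_sup] at hx
      obtain ⟨a, ha, e, he, rfl⟩ := hx
      rw [Module.End.mem_eigenspace_iff] at he
      have he' : (r • Y) e = (r * ((k + 1 : ℤ) : ℝ)) • e := by
        rw [LinearMap.smul_apply, he, smul_smul]
      have h1 := expEnd_apply_of_apply_eq_smul _ _ _ he'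
      rw [add_sub_cancel_right] at ha ⊢
      have h2 := (ih a ha).1
      -- The eigenvector `e` cancels; what remains involves only `a`, which lies in the previous
      -- step.
      have h3 : expEnd (r • Y) (a + e) - Real.exp (r * ((k + 1 : ℤ) : ℝ)) • (a + e)
          = expEnd (r • Y) a - Real.exp (r * ((k + 1 : ℤ) : ℝ)) • a := by
        rw [map_add, h1]
        module
      have h4 : expEnd (r • Y) (a + e) - Real.exp (r * ((k + 1 : ℤ) : ℝ)) • (a + e) ∈ W k := by
        rw [h3]
        exact (W k).sub_mem h2 ((W k).smul_mem _ ha)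
      refine ⟨?_, h4⟩
      have hle : W k ≤ W (k + 1) := hmono (by omega)
      have hx : a + e ∈ W (k + 1) := by
        refine (W (k + 1)).add_mem (hle ha) ?_
        rw [← hY.sup_eq]
        exact Submodule.mem_sup_right (Module.End.mem_eigenspace_iff.2 he)
      simpa using (W (k + 1)).add_mem (hle h4)
        ((W (k + 1)).smul_mem (Real.exp (r * ((k + 1 : ℤ) : ℝ))) hx)

theorem isWeightScaling_expEquiv (hY : IsRealGrading W Y) (hmono : Monotone W)
    (hbot : ∃ k, W k = ⊥) (r : ℝ) :
    IsWeightScaling W (fun k => Real.exp (r * k)) (expEquiv (r • Y)) := by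
  obtain ⟨k₀, hk₀⟩ := hbot
  refine ⟨fun k => Real.exp_pos _, fun k x hx => (hY.expEnd_sub_mem hmono hk₀ r k x hx).1,
    fun k x hx => ?_, fun k x hx => (hY.expEnd_sub_mem hmono hk₀ r k x hx).2⟩
  have h := (hY.expEnd_sub_mem hmono hk₀ (-r) k x hx).1
  rw [neg_smul] at h
  exact h

end IsRealGrading

end Scaling

/-! ### Linear algebra of internal direct sums and of the trace form -/

section LinearAlgebra

variable {E : Type*} [AddCommGroup E] [Module ℂ E]

/-- The inner product `(x, y) ↦ ⟪T x, T y⟫`. -/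
abbrev pullbackCore (c : InnerProductSpace.Core ℂ E) (T : E ≃ₗ[ℂ] E) :
    InnerProductSpace.Core ℂ E where
  inner x y := c.inner (T x) (T y)
  conj_inner_symm x y := c.conj_inner_symm (T x) (T y)
  re_inner_nonneg x := c.re_inner_nonneg (T x)
  add_left x y z := by
    rw [map_add]
    exact c.add_left (T x) (T y) (T z)
  smul_left x y r := by
    rw [map_smul]
    exact c.smul_left (T x) (T y) r
  definite x hx := T.map_eq_zero_iff.1 (c.definite (T x) hx)

theorem core_inner_smul_smul (c : InnerProductSpace.Core ℂ E) (r s : ℝ) (x y : E) :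
    c.inner ((r : ℂ) • x) ((s : ℂ) • y) = r * s * c.inner x y := by
  have h1 : c.inner ((r : ℂ) • x) ((s : ℂ) • y) = r * c.inner x ((s : ℂ) • y) := by
    have := c.smul_left x ((s : ℂ) • y) (r : ℂ)
    rwa [Complex.conj_ofReal] at this
  have h2 : c.inner x ((s : ℂ) • y) = s * c.inner x y := by
    have h := c.conj_inner_symm x ((s : ℂ) • y)
    have h' := c.smul_left y x (s : ℂ)
    have h'' := c.conj_inner_symm x y
    change starRingEnd ℂ (c.inner ((s : ℂ) • y) x) = _ at h
    change c.inner ((s : ℂ) • y) x = _ at h'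
    change starRingEnd ℂ (c.inner y x) = _ at h''
    rw [← h, h', map_mul, Complex.conj_conj, h'']
  rw [h1, h2, mul_assoc]

theorem traceForm_self_re [FiniteDimensional ℂ E] (c : InnerProductSpace.Core ℂ E)
    {ι : Type*} [Fintype ι] [DecidableEq ι] (b : Module.Basis ι ℂ E)
    (hb : ∀ i j, c.inner (b i) (b j) = if i = j then 1 else 0) (a : Module.End ℂ E) :
    (traceForm c a a).re = ∑ i, ∑ j, ‖b.repr (a (b i)) j‖ ^ 2 := by
  let _ : NormedAddCommGroup E := c.toNormedAddCommGroup
  let _ : InnerProductSpace ℂ E := InnerProductSpace.ofCore c.toCore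
  let o : OrthonormalBasis ι ℂ E := b.toOrthonormalBasis (orthonormal_iff_ite.2 hb)
  have ho : ∀ i, o i = b i := fun i => by simp [o]
  have ho' : ∀ x i, o.repr x i = b.repr x i := fun x i => by
    simp [o, Module.Basis.coe_toOrthonormalBasis_repr]
  have h : traceForm c a a = LinearMap.trace ℂ E (a * LinearMap.adjoint a) := rfl
  -- Cyclicity replaces `a a*` by `a* a`, whose diagonal entries are the squared norms of the `a (o
  -- i)`.
  rw [h, LinearMap.trace_mul_comm, LinearMap.trace_eq_sum_inner _ o, Complex.re_sum]
  refine Finset.sum_congr rfl fun i _ => ?_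
  rw [Module.End.mul_apply, LinearMap.adjoint_inner_right]
  have h2 := inner_self_eq_norm_sq (𝕜 := ℂ) (a (o i))
  rw [← o.repr.norm_map, EuclideanSpace.norm_sq_eq] at h2
  simp only [ho', ho] at h2 ⊢
  exact h2

variable {ι : Type*} [DecidableEq ι] {A : ι → Submodule ℂ E}

/-- The endomorphism which acts on the summand `A i` of `E` as multiplication by `r i`. -/
def diagonal (hA : DirectSum.IsInternal A) (r : ι → ℝ) : Module.End ℂ E :=
  let e := LinearEquiv.ofBijective (DirectSum.coeLinearMap A) hA
  e.toLinearMap ∘ₗ DirectSum.lmap (fun i => (r i : ℂ) • LinearMap.id) ∘ₗ e.symm.toLinearMap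

theorem diagonal_apply (hA : DirectSum.IsInternal A) (r : ι → ℝ) {i : ι} {x : E} (hx : x ∈ A i) :
    diagonal hA r x = (r i : ℂ) • x := by
  set e := LinearEquiv.ofBijective (DirectSum.coeLinearMap A) hA
  have h : e.symm x = DirectSum.lof ℂ ι (fun i => A i) i ⟨x, hx⟩ := by
    rw [LinearEquiv.symm_apply_eq]
    exact (DirectSum.coeLinearMap_lof A i ⟨x, hx⟩).symm
  change e (DirectSum.lmap _ (e.symm x)) = _
  rw [h, DirectSum.lmap_lof]
  exact DirectSum.coeLinearMap_lof A i _

theorem diagonal_mul_diagonal (hA : DirectSum.IsInternal A) {r s : ι → ℝ}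
    (h : ∀ i, r i * s i = 1) : diagonal hA r ∘ₗ diagonal hA s = LinearMap.id := by
  ext x
  have hx : x ∈ ⨆ i, A i := hA.submodule_iSup_eq_top ▸ Submodule.mem_top
  induction hx using Submodule.iSup_induction' with
  | mem i x hx =>
    rw [LinearMap.comp_apply, diagonal_apply hA s hx, map_smul, diagonal_apply hA r hx, smul_smul,
      ← Complex.ofReal_mul, mul_comm, h, Complex.ofReal_one, one_smul, LinearMap.id_apply]
  | zero => simp
  | add x y _ _ hx hy => rw [map_add, map_add, hx, hy]

/-- The automorphism which acts on the summand `A i` of `E` as multiplication by `r i`. -/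
def diagonalEquiv (hA : DirectSum.IsInternal A) (r : ι → ℝ) (hr : ∀ i, r i ≠ 0) : E ≃ₗ[ℂ] E :=
  LinearEquiv.ofLinearMap (diagonal hA r) (diagonal hA fun i => (r i)⁻¹)
    (diagonal_mul_diagonal hA fun i => mul_inv_cancel₀ (hr i))
    (diagonal_mul_diagonal hA fun i => inv_mul_cancel₀ (hr i))

theorem diagonalEquiv_apply (hA : DirectSum.IsInternal A) (r : ι → ℝ) (hr : ∀ i, r i ≠ 0)
    {i : ι} {x : E} (hx : x ∈ A i) : diagonalEquiv hA r hr x = (r i : ℂ) • x :=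
  diagonal_apply hA r hx

theorem exists_orthonormal_basis_of_isInternal [FiniteDimensional ℂ E]
    (c : InnerProductSpace.Core ℂ E) (hA : DirectSum.IsInternal A)
    (hc : ∀ i j, i ≠ j → ∀ u ∈ A i, ∀ v ∈ A j, c.inner v u = 0) :
    ∃ (n : ℕ) (b : Module.Basis (Fin n) ℂ E) (k : Fin n → ι), (∀ i, b i ∈ A (k i)) ∧
      ∀ i j, c.inner (b i) (b j) = if i = j then 1 else 0 := by
  let _ : NormedAddCommGroup E := c.toNormedAddCommGroup
  let _ : InnerProductSpace ℂ E := InnerProductSpace.ofCore c.toCore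
  let v := fun i => stdOrthonormalBasis ℂ (A i)
  let b := hA.collectedBasis fun i => (v i).toBasis
  have hb : ∀ i, b i = (v i.1 i.2 : E) := fun i => by
    simp [b, DirectSum.IsInternal.collectedBasis_coe]
  have : Finite (Σ i, Fin (Module.finrank ℂ (A i))) := Module.Finite.finite_basis b
  let e := Finite.equivFin (Σ i, Fin (Module.finrank ℂ (A i)))
  refine ⟨_, b.reindex e, fun i => (e.symm i).1, fun i => ?_, fun i j => ?_⟩
  · rw [Module.Basis.reindex_apply, hb]
    exact Subtype.coe_prop _
  · have key : ∀ s t : Σ i, Fin (Module.finrank ℂ (A i)),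
        c.inner (v s.1 s.2 : E) (v t.1 t.2 : E) = if s = t then 1 else 0 := by
      rintro ⟨i, a⟩ ⟨j, a'⟩
      by_cases hij : i = j
      · subst hij
        have h := orthonormal_iff_ite.1 (v i).orthonormal a a'
        rw [Submodule.coe_inner] at h
        simpa using h
      · rw [if_neg fun h => hij (congrArg Sigma.fst h)]
        exact hc j i (Ne.symm hij) _ (Subtype.coe_prop _) _ (Subtype.coe_prop _)
    rw [Module.Basis.reindex_apply, Module.Basis.reindex_apply, hb, hb, key]
    simp only [e.symm.injective.eq_iff]

/-- With `T = δ g⁻¹`, the map `T` is an isometry from the pulled-back metric to `c` and turns `g a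
g⁻¹` into `δ a δ⁻¹`. In an orthonormal basis adapted to `A` the entries of the latter are those of
`a` times `r j / r i`. Only nonzero summands contribute, so the ratios are bounded even when the
index set is infinite. -/
theorem traceForm_conj_re_le [FiniteDimensional ℂ E] (c : InnerProductSpace.Core ℂ E)
    (hA : DirectSum.IsInternal A)
    (hc : ∀ i j, i ≠ j → ∀ u ∈ A i, ∀ v ∈ A j, c.inner v u = 0)
    (r : ι → ℝ) (hr : ∀ i, r i ≠ 0) {C : ℝ}
    (hC : ∀ i j, A i ≠ ⊥ → A j ≠ ⊥ → |r j / r i| ≤ C) (g : E ≃ₗ[ℂ] E) (a : Module.End ℂ E) :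
    (traceForm (pullbackCore c (g.symm.trans (diagonalEquiv hA r hr)))
      (g.conj a) (g.conj a)).re ≤ C ^ 2 * (traceForm c a a).re := by
  obtain ⟨n, b, k, hk, hb⟩ := exists_orthonormal_basis_of_isInternal c hA hc
  set δ := diagonalEquiv hA r hr
  set T := g.symm.trans δ
  have hb' : ∀ i j, (pullbackCore c T).inner (b.map T.symm i) (b.map T.symm j)
      = if i = j then 1 else 0 := fun i j => by
    change c.inner (T (b.map T.symm i)) (T (b.map T.symm j)) = _
    rw [Module.Basis.map_apply, Module.Basis.map_apply, LinearEquiv.apply_symm_apply,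
      LinearEquiv.apply_symm_apply, hb]
  rw [traceForm_self_re _ _ hb', traceForm_self_re _ _ hb, Finset.mul_sum]
  have hδ : ∀ x j, b.repr (δ x) j = r (k j) * b.repr x j := fun x j => by
    have : (b.coord j) ∘ₗ δ.toLinearMap = (r (k j) : ℂ) • b.coord j := by
      refine b.ext fun i => ?_
      simp only [LinearMap.comp_apply, LinearEquiv.coe_coe, LinearMap.smul_apply,
        Module.Basis.coord_apply, δ]
      rw [diagonalEquiv_apply hA r hr (hk i), map_smul, Finsupp.smul_apply, b.repr_self]
      by_cases hij : i = j
      · rw [hij]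
      · simp [Finsupp.single_eq_of_ne' hij]
    exact LinearMap.congr_fun this x
  have hδs : ∀ i, δ.symm (b i) = ((r (k i))⁻¹ : ℂ) • b i := fun i => by
    rw [LinearEquiv.symm_apply_eq, map_smul, diagonalEquiv_apply hA r hr (hk i), smul_smul,
      inv_mul_cancel₀ (by exact_mod_cast hr _), one_smul]
  have hne : ∀ i, A (k i) ≠ ⊥ := fun i h => by
    have h1 := hk i
    rw [h, Submodule.mem_bot] at h1
    exact b.ne_zero i h1
  refine Finset.sum_le_sum fun i _ => ?_
  rw [Finset.mul_sum]
  refine Finset.sum_le_sum fun j _ => ?_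
  have h1 : (b.map T.symm).repr ((g.conj a) (b.map T.symm i)) j
      = ((r (k j) / r (k i) : ℝ) : ℂ) * b.repr (a (b i)) j := by
    rw [Module.Basis.map_repr, Module.Basis.map_apply]
    simp only [LinearEquiv.trans_apply, LinearEquiv.symm_symm, LinearEquiv.conj_apply_apply, T,
      LinearEquiv.symm_trans_apply, LinearEquiv.symm_apply_apply]
    rw [hδs, map_smul, map_smul, map_smul, Finsupp.smul_apply, hδ]
    push_cast
    rw [smul_eq_mul]
    ring
  rw [h1, norm_mul, mul_pow, Complex.norm_real, Real.norm_eq_abs]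
  have h2 := hC _ _ (hne i) (hne j)
  gcongr

end LinearAlgebra

/-! ### Transport of mixed Hodge structures by a weight scaling -/

namespace Data

variable {V : Type*} [AddCommGroup V] [Module ℝ V] {D : Data V} {c : ℤ → ℝ} {g : V ≃ₗ[ℝ] V}
  {F : ℤ → Submodule ℂ (Cx V)} {I : ℤ → ℤ → Submodule ℂ (Cx V)}

theorem act_mem_M (hg : IsWeightScaling D.W c g) (hF : F ∈ D.M) :
    act (cxEquiv g : Module.End ℂ (Cx V)) F ∈ D.M := by
  obtain ⟨hanti, ⟨p, hp⟩, ⟨q, hq⟩, h⟩ := hF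
  refine ⟨fun a b hab => Submodule.map_mono (hanti hab), ⟨p, ?_⟩, ⟨q, ?_⟩, ?_⟩
  · rw [act, hp, Submodule.map_top, LinearEquiv.range]
  · rw [act, hq, Submodule.map_bot]
  · rw [hg.grFiltration_act]
    exact h

/-- Reality of `g` is what transports the congruence modulo lower terms, since `g` must commute with
conjugation. -/
theorem IsDeligneBigrading.map (hI : D.IsDeligneBigrading F I) (hg : IsWeightScaling D.W c g) :
    D.IsDeligneBigrading (act (cxEquiv g : Module.End ℂ (Cx V)) F)
      (fun p q => (I p q).map (cxEquiv g : Module.End ℂ (Cx V))) where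
  isInternal := by
    have h := (DirectSum.isInternal_submodule_iff_iSupIndep_and_iSup_eq_top _).1 hI.isInternal
    rw [DirectSum.isInternal_submodule_iff_iSupIndep_and_iSup_eq_top]
    refine ⟨h.1.map_orderIso (Submodule.orderIsoMapComap (cxEquiv g)), ?_⟩
    rw [← Submodule.map_iSup, h.2, Submodule.map_top, LinearEquiv.range]
  hodge p := by
    simp only [act, hI.hodge p, Submodule.map_iSup]
  weight k := by
    rw [← hg.map_baseChange, hI.weight k]
    simp only [Submodule.map_iSup]
  conj_mod p q := by
    have h := congrArg (Submodule.map (cxEquiv g : Module.End ℂ (Cx V))) (hI.conj_mod p q)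
    simpa only [Submodule.map_sup, Submodule.map_iSup, conjSubspace_map] using h

theorem IsInLieAlgebra.conj {X : Module.End ℂ (Cx V)} (hX : D.IsInLieAlgebra X)
    (hg : IsWeightScaling D.W c g) : D.IsInLieAlgebra ((cxEquiv g).conj X) := by
  refine ⟨fun w => ?_, fun w u v u' v' hu hv => ?_⟩
  · rintro _ ⟨x, hx, rfl⟩
    rw [SetLike.mem_coe, ← hg.map_baseChange w, Submodule.mem_map_equiv] at hx
    rw [← hg.map_baseChange w, LinearEquiv.conj_apply_apply]
    exact Submodule.mem_map_of_mem (hX.1 w (Submodule.mem_map_of_mem hx))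
  · have key : ∀ {a a' : Cx (D.W w)}, incl D.W w a' = (cxEquiv g).conj X (incl D.W w a) →
        incl D.W w (hg.pull w a') = X (incl D.W w (hg.pull w a)) := fun {a a'} h => by
      rw [hg.incl_pull, hg.incl_pull, h, LinearEquiv.conj_apply_apply,
        LinearEquiv.symm_apply_apply]
    have h := hX.2 w _ _ _ _ (key hu) (key hv)
    rw [hg.gr_eq_smul_gr_pull w u, hg.gr_eq_smul_gr_pull w v, hg.gr_eq_smul_gr_pull w u',
      hg.gr_eq_smul_gr_pull w v']
    simp only [map_smul, LinearMap.smul_apply, ← smul_add, h, smul_zero]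

theorem conj_mem_tangentModel {v : Module.End ℂ (Cx V)} (hv : v ∈ D.tangentModel I)
    (hg : IsWeightScaling D.W c g) :
    (cxEquiv g).conj v
      ∈ D.tangentModel (fun p q => (I p q).map (cxEquiv g : Module.End ℂ (Cx V))) := by
  unfold tangentModel at hv
  induction hv using Submodule.span_induction with
  | mem X hX =>
    refine Submodule.subset_span ?_
    simp only [mem_iUnion] at hX ⊢
    obtain ⟨p, q, hpq, hL, hX⟩ := hX
    refine ⟨p, q, hpq, hL.conj hg, fun a b => ?_⟩
    rintro _ ⟨_, ⟨x, hx, rfl⟩, rfl⟩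
    rw [LinearEquiv.coe_coe, LinearEquiv.conj_apply_apply, LinearEquiv.symm_apply_apply]
    exact Submodule.mem_map_of_mem (hX a b (Submodule.mem_map_of_mem hx))
  | zero => rw [map_zero]; exact Submodule.zero_mem _
  | add X X' _ _ h h' => rw [map_add]; exact Submodule.add_mem _ h h'
  | smul r X _ h => rw [map_smul]; exact Submodule.smul_mem _ r h

/-- `g` need not be an isometry on `Gr_w`, but both sides of the isometry condition acquire the same
factor `c w ^ 2`. -/
theorem conj_mem_GC {k : Cx V ≃ₗ[ℂ] Cx V} (hk : k ∈ D.GC) (hg : IsWeightScaling D.W c g) :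
    ((cxEquiv g).symm.trans k).trans (cxEquiv g) ∈ D.GC := by
  refine ⟨fun w => ?_, fun w u v u' v' hu hv => ?_⟩
  · have h : (((cxEquiv g).symm.trans k).trans (cxEquiv g) : Module.End ℂ (Cx V))
        = (cxEquiv g : Module.End ℂ (Cx V)) ∘ₗ (k : Module.End ℂ (Cx V)) ∘ₗ
          ((cxEquiv g).symm : Module.End ℂ (Cx V)) := rfl
    rw [h, Submodule.map_comp, Submodule.map_comp, cxEquiv_symm, hg.symm.map_baseChange, hk.1,
      hg.map_baseChange]
  · have key : ∀ {a a' : Cx (D.W w)},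
        incl D.W w a' = ((cxEquiv g).symm.trans k).trans (cxEquiv g) (incl D.W w a) →
        incl D.W w (hg.pull w a') = k (incl D.W w (hg.pull w a)) := fun {a a'} h => by
      rw [hg.incl_pull, hg.incl_pull, h]
      simp only [LinearEquiv.trans_apply, LinearEquiv.symm_apply_apply]
    have h := hk.2 w _ _ _ _ (key hu) (key hv)
    rw [hg.gr_eq_smul_gr_pull w u, hg.gr_eq_smul_gr_pull w v, hg.gr_eq_smul_gr_pull w u',
      hg.gr_eq_smul_gr_pull w v']
    simp only [map_smul, LinearMap.smul_apply, h]

theorem HasVelocity.act {γ : ℝ → ℤ → Submodule ℂ (Cx V)} {u : ℝ} {v : Module.End ℂ (Cx V)}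
    (h : D.HasVelocity γ u v) (hg : IsWeightScaling D.W c g) :
    D.HasVelocity (fun t => act (cxEquiv g : Module.End ℂ (Cx V)) (γ t)) u
      ((cxEquiv g).conj v) := by
  obtain ⟨k, hk, hku, hsmooth, hderiv⟩ := h
  -- The witness is `g k(t) g⁻¹`; its matrix coefficients are those of `k(t)` for the pair `φ ∘ g`,
  -- `g⁻¹ x`.
  refine ⟨fun t => ((cxEquiv g).symm.trans (k t)).trans (cxEquiv g), ?_, ?_, fun φ x => ?_,
    fun φ x => ?_⟩
  · filter_upwards [hk] with t ht
    refine ⟨conj_mem_GC ht.1 hg, ?_⟩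
    rw [ht.2]
    funext p
    simp only [MixedHodge.act, ← Submodule.map_comp]
    congr 1
    refine LinearMap.ext fun x => ?_
    change cxEquiv g (k t x) = cxEquiv g (k t ((cxEquiv g).symm (cxEquiv g x)))
    rw [LinearEquiv.symm_apply_apply]
  · ext x
    simp [hku]
  · exact hsmooth (φ ∘ₗ (cxEquiv g).toLinearMap) ((cxEquiv g).symm x)
  · exact hderiv (φ ∘ₗ (cxEquiv g).toLinearMap) ((cxEquiv g).symm x)

/-- On `g I^{p,q}` each argument of the graded form contributes a factor `c (p+q)` relative to its
preimage under `g`; the two copies of `δ` supply exactly this square. -/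
theorem IsMixedHodgeMetric.map {m : InnerProductSpace.Core ℂ (Cx V)}
    (hm : D.IsMixedHodgeMetric I m) (hg : IsWeightScaling D.W c g)
    (hI : DirectSum.IsInternal fun pq : ℤ × ℤ => I pq.1 pq.2) :
    D.IsMixedHodgeMetric (fun p q => (I p q).map (cxEquiv g : Module.End ℂ (Cx V)))
      (pullbackCore m ((cxEquiv g).symm.trans
        (diagonalEquiv hI (fun pq => c (pq.1 + pq.2)) fun _ => (hg.pos _).ne'))) := by
  set δ := diagonalEquiv hI (fun pq => c (pq.1 + pq.2)) fun _ => (hg.pos _).ne'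
  have hδ : ∀ p q, ∀ x ∈ I p q, δ x = (c (p + q) : ℂ) • x := fun p q x hx =>
    diagonalEquiv_apply hI (fun pq : ℤ × ℤ => c (pq.1 + pq.2)) (fun _ => (hg.pos _).ne')
      (i := (p, q)) hx
  refine ⟨?_, fun p q u v hu hv => ?_⟩
  · rintro p q p' q' hne _ ⟨u, hu, rfl⟩ _ ⟨v, hv, rfl⟩
    change m.inner (δ ((cxEquiv g).symm (cxEquiv g v))) (δ ((cxEquiv g).symm (cxEquiv g u))) = 0
    rw [LinearEquiv.symm_apply_apply, LinearEquiv.symm_apply_apply, hδ _ _ _ hu, hδ _ _ _ hv,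
      core_inner_smul_smul, hm.orthogonal p q p' q' hne u hu v hv, mul_zero]
  · rw [Submodule.mem_map_equiv, ← hg.incl_pull] at hu hv
    change m.inner (δ ((cxEquiv g).symm _)) (δ ((cxEquiv g).symm _)) = _
    rw [← hg.incl_pull, ← hg.incl_pull, hδ _ _ _ hu, hδ _ _ _ hv, core_inner_smul_smul,
      hm.inner_eq p q _ _ hu hv, hg.gr_eq_smul_gr_pull _ u, hg.gr_eq_smul_gr_pull _ (conj _ v),
      hg.conj_pull]
    simp only [map_smul, LinearMap.smul_apply, smul_eq_mul]
    ring

/-! ### The weights of the Deligne bigrading -/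

theorem IsDeligneBigrading.weight_le (hI : D.IsDeligneBigrading F I) {p q m : ℤ}
    (hpq : I p q ≠ ⊥) (hm : D.W m = ⊤) : p + q ≤ m := by
  by_contra! hlt
  apply hpq
  have hind := ((DirectSum.isInternal_submodule_iff_iSupIndep_and_iSup_eq_top _).1
    hI.isInternal).1 (p, q)
  have htop : (D.W m).baseChange ℂ = ⊤ := by rw [hm, Submodule.baseChange_top]
  rw [hI.weight] at htop
  -- Were `p + q > m`, the other pieces would already span `V_ℂ`, and independence would force `I p
  -- q = ⊥`.
  have hle : (⨆ (a : ℤ) (b : ℤ) (_ : a + b ≤ m), I a b)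
      ≤ ⨆ (j : ℤ × ℤ) (_ : j ≠ (p, q)), I j.1 j.2 := by
    refine iSup_le fun a => iSup_le fun b => iSup_le fun hab => ?_
    refine le_iSup₂_of_le (f := fun (j : ℤ × ℤ) (_ : j ≠ (p, q)) => I j.1 j.2) (a, b) ?_ le_rfl
    rintro ⟨⟩
    omega
  rw [htop, top_le_iff] at hle
  rw [hle] at hind
  exact disjoint_top.1 hind

theorem IsDeligneBigrading.lt_weight (hI : D.IsDeligneBigrading F I) {p q m : ℤ}
    (hpq : I p q ≠ ⊥) (hm : D.W m = ⊥) : m < p + q := by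
  by_contra! hle
  apply hpq
  have hbot : (D.W m).baseChange ℂ = ⊥ := by rw [hm, Submodule.baseChange_bot]
  rw [hI.weight] at hbot
  rw [eq_bot_iff, ← hbot]
  exact le_iSup_of_le p (le_iSup_of_le q (le_iSup_of_le hle le_rfl))

/-- The lowest weight strictly exceeds the last index with `W = 0`, while the highest may equal the
first with `W = V`; this asymmetry gives `L - 1` instead of `L`. -/
theorem IsDeligneBigrading.weight_sub_le (hI : D.IsDeligneBigrading F I) {p q p' q' : ℤ}
    (h : I p q ≠ ⊥) (h' : I p' q' ≠ ⊥) : p + q - (p' + q') ≤ filtrationLength D.W - 1 := by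
  have h1 : p + q ≤ sInf {k | D.W k = ⊤} := le_csInf D.exists_top fun m hm => hI.weight_le h hm
  have h2 : sSup {k | D.W k = ⊥} ≤ p' + q' - 1 :=
    csSup_le D.exists_bot fun m hm => Int.le_sub_one_of_lt (hI.lt_weight h' hm)
  unfold filtrationLength
  omega

/-! ### Comparison of lengths -/

variable [FiniteDimensional ℝ V]

theorem HasSpeed.act {γ : ℝ → ℤ → Submodule ℂ (Cx V)} {u s C : ℝ} (h : D.HasSpeed γ u s)
    (hg : IsWeightScaling D.W c g) (hC0 : 0 ≤ C)
    (hC : ∀ k l : ℤ, k - l ≤ filtrationLength D.W - 1 → c l / c k ≤ C) :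
    ∃ s' ≤ C * s, D.HasSpeed (fun t => act (cxEquiv g : Module.End ℂ (Cx V)) (γ t)) u s' := by
  obtain ⟨I, m, v, hI, hm, hv, hvel, rfl⟩ := h
  refine ⟨_, ?_, _, _, _, hI.map hg, hm.map hg hI.isInternal, conj_mem_tangentModel hv hg,
    hvel.act hg, rfl⟩
  rw [← Real.sqrt_sq hC0, ← Real.sqrt_mul (sq_nonneg C)]
  refine Real.sqrt_le_sqrt (traceForm_conj_re_le m hI.isInternal ?_ _ _ ?_ _ _)
  · rintro ⟨p, q⟩ ⟨p', q'⟩ hne x hx y hy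
    exact hm.orthogonal p q p' q' hne x hx y hy
  · rintro ⟨p, q⟩ ⟨p', q'⟩ h h'
    rw [abs_of_pos (div_pos (hg.pos _) (hg.pos _))]
    exact hC _ _ (hI.weight_sub_le h h')

theorem dist_act_le (hg : IsWeightScaling D.W c g) {C : ℝ} (hC0 : 0 < C)
    (hC : ∀ k l : ℤ, k - l ≤ filtrationLength D.W - 1 → c l / c k ≤ C)
    (F F' : ℤ → Submodule ℂ (Cx V)) :
    D.dist (act (cxEquiv g : Module.End ℂ (Cx V)) F) (act (cxEquiv g : Module.End ℂ (Cx V)) F')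
      ≤ ENNReal.ofReal C * D.dist F F' := by
  have hne : ENNReal.ofReal C ≠ 0 := (ENNReal.ofReal_pos.2 hC0).ne'
  conv_rhs => rw [dist]
  -- Positivity of `C` matters here: the infimum may run over an empty set and equal `∞`.
  simp only [ENNReal.mul_iInf_of_ne hne ENNReal.ofReal_ne_top]
  refine le_iInf fun γ => le_iInf fun s => le_iInf fun hγ => ?_
  obtain ⟨h0, h1, hγ⟩ := hγ
  choose! s' hs' hspeed using fun u (hu : u ∈ Icc (0 : ℝ) 1) => (hγ u hu).2.act hg hC0.le hC
  have h : D.dist (act (cxEquiv g : Module.End ℂ (Cx V)) F)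
      (act (cxEquiv g : Module.End ℂ (Cx V)) F')
        ≤ ∫⁻ u in Icc (0 : ℝ) 1, ENNReal.ofReal (s' u) :=
    iInf_le_of_le (fun t => act (cxEquiv g : Module.End ℂ (Cx V)) (γ t)) <|
      iInf_le_of_le s' <| iInf_le_of_le ⟨congrArg (act _) h0, congrArg (act _) h1, fun u hu =>
        ⟨act_mem_M hg (hγ u hu).1, hspeed u hu⟩⟩ le_rfl
  refine h.trans ?_
  -- Finiteness of the constant lets it enter the integral without measurability of the speed.
  rw [← MeasureTheory.lintegral_const_mul' _ _ ENNReal.ofReal_ne_top]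
  refine MeasureTheory.setLIntegral_mono' measurableSet_Icc fun u hu => ?_
  rw [← ENNReal.ofReal_mul hC0.le]
  exact ENNReal.ofReal_le_ofReal (hs' u hu)

end Data

end MixedHodge

end

theorem mainTheorem10 {V : Type*} [AddCommGroup V] [Module ℝ V] [FiniteDimensional ℝ V]
    [Nontrivial V] (D : MixedHodge.Data V) (Y : Module.End ℝ V)
    (hY : MixedHodge.IsRealGrading D.W Y) (α y : ℝ) (hα : α < 0) (hy : 1 < y)
    (F F' : ℤ → Submodule ℂ (MixedHodge.Cx V)) (hF : F ∈ D.M) (hF' : F' ∈ D.M) :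
    MixedHodge.act ((MixedHodge.powEnd y (α • Y)).baseChange ℂ) F ∈ D.M ∧
    MixedHodge.act ((MixedHodge.powEnd y (α • Y)).baseChange ℂ) F' ∈ D.M ∧
    D.dist (MixedHodge.act ((MixedHodge.powEnd y (α • Y)).baseChange ℂ) F)
        (MixedHodge.act ((MixedHodge.powEnd y (α • Y)).baseChange ℂ) F')
      ≤ ENNReal.ofReal (y ^ (-α * ((MixedHodge.filtrationLength D.W : ℝ) - 1)))
        * D.dist F F' := by
  have hg := hY.isWeightScaling_expEquiv D.monotone D.exists_bot (Real.log y * α)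
  have hpow : (MixedHodge.powEnd y (α • Y)).baseChange ℂ
      = (MixedHodge.cxEquiv (MixedHodge.expEquiv ((Real.log y * α) • Y)) :
        Module.End ℂ (MixedHodge.Cx V)) := by
    rw [MixedHodge.powEnd, smul_smul]
    rfl
  rw [hpow]
  refine ⟨MixedHodge.Data.act_mem_M hg hF, MixedHodge.Data.act_mem_M hg hF',
    MixedHodge.Data.dist_act_le hg (Real.rpow_pos_of_pos (by linarith) _) (fun k l hkl => ?_) F F'⟩
  -- On exponents the claim is `k - l ≤ L - 1` multiplied by `-α log y ≥ 0`; this is where the signs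
  -- of `α` and `log y` enter.
  rw [← Real.exp_sub, Real.rpow_def_of_pos (by linarith), Real.exp_le_exp]
  have hkl' : (k : ℝ) - l ≤ (MixedHodge.filtrationLength D.W : ℝ) - 1 := by exact_mod_cast hkl
  have h := mul_le_mul_of_nonneg_left hkl'
    (mul_nonneg (Real.log_pos hy).le (neg_pos.2 hα).le)
  linarith
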